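/- Let the Fibonacci polynomials be defined by $F_0(x)=0$, $F_1(x)=1$ and $F_{m}(x)=xF_{m-1}(x)+F_{m-2}(x)$ for $m\ge 2$, and regard $F_m$ as a map $\mathbb{Z}_2\to\mathbb{Z}_2$. For a nonnegative integer $q=\sum_i c_i2^i$ with $c_i\in\{0,1\}$ (and $c_i=0$ beyond the leading digit) put $t(q)=\min\{i\ge 0: c_i=c_{i+1}\}$. For a self-map $f$ of $\mathbb{Z}_2$, the attracting basin of a nonempty set $A\subseteq\mathbb{Z}_2$ is the set of all $x$ such that the distance from $f^j(x)$ to $A$ tends to $0$ as $j\to\infty$. A minimal decomposition for $f$ is a partition $\mathbb{Z}_2=\mathcal{P}\sqcup\big(\bigsqcup_i \mathcal{M}_i\big)\sqcup\mathcal{B}$ where $\mathcal{P}$ is finite and is the set of all periodic points of $f$; the at most countably many pairwise disjoint sets $\mathcal{M}_i$ (the minimal components) are nonempty, clopen, finite unions of balls, satisfy $f(\mathcal{M}_i)\subseteq \mathcal{M}_i$, and every orbit in $\mathcal{M}_i$ is dense in $\mathcal{M}_i$; and each point of $\mathcal{B}$ lies in the attracting basin of a periodic orbit or of some $\mathcal{M}_i$.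 Theorem. Let $m=6+12q$ with $q=2+4d$ for a nonnegative integer $d$, and let $t=t(q)$. Then the minimal decomposition of $\mathbb{Z}_2$ for $F_m$ is $$\mathbb{Z}_2=\{0\}\ \sqcup\ \Big(\bigsqcup_{n\ge 1}\ \bigsqcup_{k=0}^{2^{t+1}-1} M_{n,k}\Big)\ \sqcup\ (1+2\mathbb{Z}_2),$$ where $$M_{n,k}=\big((1+4k)2^n+2^{n+t+3}\mathbb{Z}_2\big)\cup\big((2^{t+2}-1-4k)2^n+2^{n+t+3}\mathbb{Z}_2\big).$$ Here $0$ is a fixed point, the sets $M_{n,k}$ are the minimal components, and the clopen set $1+2\mathbb{Z}_2$ is the attracting basin of $\{0\}$ and the $M_{n,k}$ collectively: it is exactly the set of points outside $\{0\}\cup\bigcup_{n,k}M_{n,k}$ that lie in the attracting basin of $\{0\}$ or of some $M_{n,k}$. -/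

import Mathlib

open Filter Topology

/-- The Fibonacci polynomials `F_m` over `ℤ₂`: `F_0 = 0`, `F_1 = 1`,
`F_{m+2} = x F_{m+1} + F_m`. -/
noncomputable def fibPoly : ℕ → Polynomial ℤ_[2]
  | 0 => 0
  | 1 => 1
  | m + 2 => Polynomial.X * fibPoly (m + 1) + fibPoly m

/-- The self-map `x ↦ F_m(x)` of `ℤ₂`. -/
noncomputable def fibMap (m : ℕ) : ℤ_[2] → ℤ_[2] := fun x => (fibPoly m).eval x

/-- `t(q) = min {i ≥ 0 | c_i = c_{i+1}}`, where `q = ∑ c_i 2^i` is the binary expansion of `q`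
(with `c_i = 0` beyond the leading digit). -/
noncomputable def tInv (q : ℕ) : ℕ := sInf {i : ℕ | q.testBit i = q.testBit (i + 1)}

/-- The minimum in the definition of `t(q)` is attained. -/
theorem tInv_isLeast (q : ℕ) : IsLeast {i : ℕ | q.testBit i = q.testBit (i + 1)} (tInv q) := by
  have hne : {i : ℕ | q.testBit i = q.testBit (i + 1)}.Nonempty := by
    refine ⟨q, ?_⟩
    have h0 : q < 2 ^ q := Nat.lt_two_pow_self
    have h1 : q < 2 ^ (q + 1) := h0.trans (Nat.pow_lt_pow_right (by norm_num) (Nat.lt_succ_self q))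
    simp [Nat.testBit_lt_two_pow h0, Nat.testBit_lt_two_pow h1]
  exact ⟨Nat.sInf_mem hne, fun _ hi => Nat.sInf_le hi⟩

/-- The ball `a + 2^l ℤ₂`. -/
def twoBall (a : ℤ_[2]) (l : ℕ) : Set ℤ_[2] := {x | ∃ z : ℤ_[2], x = a + 2 ^ l * z}

/-- `M_{n,k} = ((1+4k)2^n + 2^{n+t+3} ℤ₂) ∪ ((2^{t+2}-1-4k)2^n + 2^{n+t+3} ℤ₂)`. -/
def compSet (t n k : ℕ) : Set ℤ_[2] :=
  twoBall ((1 + 4 * (k : ℤ_[2])) * 2 ^ n) (n + t + 3) ∪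
    twoBall ((2 ^ (t + 2) - 1 - 4 * (k : ℤ_[2])) * 2 ^ n) (n + t + 3)

/-- The forward orbit of `x` under `f`. -/
def fwdOrbit {X : Type*} (f : X → X) (x : X) : Set X := Set.range fun j : ℕ => f^[j] x

/-- The subsystem `f : A → A` is minimal: `A` is nonempty, `f` maps `A` into itself, and the
forward orbit of every point of `A` is dense in `A`. -/
structure IsMinimalSubsystem {X : Type*} [TopologicalSpace X] (f : X → X) (A : Set X) : Prop where
  nonempty : A.Nonempty
  mapsTo : Set.MapsTo f A A
  dense : ∀ x ∈ A, A ⊆ closure (fwdOrbit f x)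

/-- The attracting basin of `A`: the points `x` whose distance to `A` along the orbit,
`dist (f^j x, A)`, tends to `0`. -/
def attractingBasin {X : Type*} [PseudoEMetricSpace X] (f : X → X) (A : Set X) : Set X :=
  {x | Tendsto (fun j : ℕ => Metric.infEDist (f^[j] x) A) atTop (𝓝 0)}

/-- `A` is a finite union of balls (of positive radius). -/
def IsFiniteUnionOfBalls {X : Type*} [PseudoMetricSpace X] (A : Set X) : Prop :=
  ∃ s : Set (X × ℝ), s.Finite ∧ (∀ c ∈ s, 0 < c.2) ∧ A = ⋃ c ∈ s, Metric.closedBall c.1 c.2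

/-- `X = P ⊔ (⨆ i, M i) ⊔ B` is a minimal decomposition for `f : X → X`, with minimal
components `M i`. -/
structure IsMinimalDecomposition {X ι : Type*} [PseudoMetricSpace X] (f : X → X)
    (P : Set X) (M : ι → Set X) (B : Set X) : Prop where
  cover : P ∪ (⋃ i, M i) ∪ B = Set.univ
  disjoint_P_M : Disjoint P (⋃ i, M i)
  disjoint_P_B : Disjoint P B
  disjoint_M_B : Disjoint (⋃ i, M i) B
  /-- `P` is the set of all periodic points, and it is finite. -/
  P_eq : P = Function.periodicPts f
  P_finite : P.Finite
  /-- There are at most countably many components; they are pairwise disjoint, clopen, finite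
  unions of balls, invariant, and minimal. -/
  countable : Countable ι
  pairwise_disjoint : Pairwise fun i j => Disjoint (M i) (M j)
  isClopen : ∀ i, IsClopen (M i)
  balls : ∀ i, IsFiniteUnionOfBalls (M i)
  minimal : ∀ i, IsMinimalSubsystem f (M i)
  /-- Each point of `B` is attracted by a periodic orbit or by a minimal component. -/
  attracted : ∀ x ∈ B,
    (∃ p ∈ Function.periodicPts f, x ∈ attractingBasin f (fwdOrbit f p)) ∨
      ∃ i, x ∈ attractingBasin f (M i)

/-! ### Divisibility by two in `ℤ₂` -/

/-! Write $m=2r$. The binary digits of $q$ give $r+1=2(3q+2)=2^{t+2}o$ with $o$ odd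
(`exists_three_mul_add_two_eq`). In $F_{2r}(x)=\sum_i\binom{r+i}{2i+1}x^{2i+1}$ the terms beyond
$rx$ are so divisible by 2 at even $x$ that $F(x)=x(-1+2^{t+2}(o+4e))$
(`fibMap_even_eq_mul_neg_one_add`).

Hence $F(2^nu)=2^n(-u+2^{t+2}w)$ with $w$ odd whenever $n\ge1$ and $u$ is odd, so $F$ exchanges the
two balls of each $M_{n,k}$. The second iterate moves every point by exactly $2^{-(n+t+3)}$ and has
difference quotients $\equiv1$ mod 4. Its $2^j$-th iterates then move points by exactly
$2^{-(n+t+3+j)}$, so any point of the same ball is approached one binary digit at a time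
(`exists_iterate_two_pow_dvd_sub`); this is minimality.

The $M_{n,k}$ partition the nonzero even integers. Since $3\mid m$, odd points become even after one
step. -/

theorem two_adic_even_or_odd (z : ℤ_[2]) : Even z ∨ Odd z := by
  have h := PadicInt.appr_spec 1 z
  rw [Ideal.mem_span_singleton] at h
  obtain ⟨c, hc⟩ := h
  have hz : z = (PadicInt.appr z 1 : ℤ_[2]) + 2 * c := by
    rw [sub_eq_iff_eq_add'] at hc
    rw [← pow_one (2 : ℤ_[2])]
    exact_mod_cast hc
  rcases Nat.even_or_odd (PadicInt.appr z 1) with h | h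
  · left
    rw [hz]
    exact (h.natCast (α := ℤ_[2])).add (even_two_mul c)
  · right
    rw [hz]
    exact (h.natCast (R := ℤ_[2])).add_even (even_two_mul c)

theorem two_adic_two_prime : Prime (2 : ℤ_[2]) := by
  exact_mod_cast PadicInt.prime_p (p := 2)

theorem two_adic_not_even_of_odd {z : ℤ_[2]} (h : Odd z) : ¬ Even z := by
  intro he
  have h1 : (2 : ℤ_[2]) ∣ 1 := by
    obtain ⟨k, rfl⟩ := h
    have := he.two_dvd
    exact (dvd_add_right (Dvd.intro k rfl)).mp this
  exact two_adic_two_prime.not_isUnit (isUnit_of_dvd_one h1)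

theorem two_adic_not_dvd_of_odd {z : ℤ_[2]} (h : Odd z) : ¬ (2 : ℤ_[2]) ∣ z :=
  fun h2 => two_adic_not_even_of_odd h (even_iff_two_dvd.mpr h2)

/-- Cancelling an odd factor from a divisibility by a power of two. -/
theorem two_pow_dvd_of_dvd_odd_mul {u z : ℤ_[2]} (hu : Odd u) {n : ℕ}
    (h : (2 : ℤ_[2]) ^ n ∣ u * z) : (2 : ℤ_[2]) ^ n ∣ z :=
  two_adic_two_prime.pow_dvd_of_dvd_mul_left n (two_adic_not_dvd_of_odd hu) h

theorem exists_two_pow_mul_odd {x : ℤ_[2]} (hx : x ≠ 0) :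
    ∃ (n : ℕ) (u : ℤ_[2]), Odd u ∧ x = 2 ^ n * u := by
  refine ⟨x.valuation, PadicInt.unitCoeff hx, ?_, ?_⟩
  · rcases two_adic_even_or_odd (PadicInt.unitCoeff hx : ℤ_[2]) with h | h
    · exact absurd (isUnit_of_dvd_unit h.two_dvd (Units.isUnit _)) two_adic_two_prime.not_isUnit
    · exact h
  · have := PadicInt.unitCoeff_spec hx
    rw [mul_comm]
    exact_mod_cast this

theorem two_pow_mul_odd_exponent_le {a b : ℕ} {u v : ℤ_[2]} (hv : Odd v)
    (h : (2 : ℤ_[2]) ^ a * u = 2 ^ b * v) : a ≤ b := by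
  by_contra! hab
  obtain ⟨c, rfl⟩ := Nat.exists_eq_add_of_lt hab
  have h2 : (2 : ℤ_[2]) ^ b * (2 * (2 ^ c * u)) = 2 ^ b * v := by rw [← h]; ring
  have h3 := mul_left_cancel₀ (pow_ne_zero b two_ne_zero) h2
  exact two_adic_not_dvd_of_odd hv ⟨_, h3.symm⟩

theorem two_pow_mul_odd_inj {a b : ℕ} {u v : ℤ_[2]} (hu : Odd u) (hv : Odd v)
    (h : (2 : ℤ_[2]) ^ a * u = 2 ^ b * v) : a = b ∧ u = v := by
  have hab : a = b :=
    le_antisymm (two_pow_mul_odd_exponent_le hv h) (two_pow_mul_odd_exponent_le hu h.symm)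
  subst hab
  exact ⟨rfl, mul_left_cancel₀ (pow_ne_zero a two_ne_zero) h⟩

theorem two_pow_dvd_natCast_sub {k l N : ℕ} (hk : k < 2 ^ N) (hl : l < 2 ^ N)
    (h : (2 : ℤ_[2]) ^ N ∣ (k : ℤ_[2]) - l) : k = l := by
  have h1 : ((2 : ℕ) ^ N : ℤ) ∣ ((k : ℤ) - l) := by
    rw [← PadicInt.pow_p_dvd_int_iff]
    push_cast
    exact_mod_cast h
  have h2 : (l : ℤ) ≡ k [ZMOD ((2 ^ N : ℕ) : ℤ)] :=
    (Int.modEq_iff_dvd).mpr (by exact_mod_cast h1)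
  have h3 := (Int.natCast_modEq_iff).mp h2
  exact (h3.eq_of_lt_of_lt hl hk).symm

/-! ### Balls -/

theorem mem_twoBall_iff {a x : ℤ_[2]} {l : ℕ} : x ∈ twoBall a l ↔ (2 : ℤ_[2]) ^ l ∣ x - a := by
  constructor
  · rintro ⟨z, rfl⟩
    exact ⟨z, by ring⟩
  · rintro ⟨z, hz⟩
    exact ⟨z, by rw [← hz]; ring⟩

theorem two_pow_dvd_iff_norm_le {z : ℤ_[2]} {l : ℕ} :
    (2 : ℤ_[2]) ^ l ∣ z ↔ ‖z‖ ≤ (2 : ℝ) ^ (-l : ℤ) := by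
  have := PadicInt.norm_le_pow_iff_mem_span_pow z l
  rw [Ideal.mem_span_singleton] at this
  exact_mod_cast this.symm

theorem twoBall_eq_closedBall (a : ℤ_[2]) (l : ℕ) :
    twoBall a l = Metric.closedBall a ((2 : ℝ) ^ (-l : ℤ)) := by
  ext x
  rw [mem_twoBall_iff, two_pow_dvd_iff_norm_le, Metric.mem_closedBall, dist_eq_norm]

theorem isClopen_twoBall (a : ℤ_[2]) (l : ℕ) : IsClopen (twoBall a l) := by
  rw [twoBall_eq_closedBall]
  exact IsUltrametricDist.isClopen_closedBall a (by positivity)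

theorem twoBall_infinite (a : ℤ_[2]) (l : ℕ) : (twoBall a l).Infinite := by
  have h : twoBall a l = Set.range fun z : ℤ_[2] => a + 2 ^ l * z := by
    ext x
    simp [twoBall, eq_comm]
  rw [h]
  refine Set.infinite_range_of_injective fun y z hyz => ?_
  exact mul_left_cancel₀ (pow_ne_zero l two_ne_zero) (add_left_cancel hyz)

theorem isClopen_compSet (t n k : ℕ) : IsClopen (compSet t n k) :=
  (isClopen_twoBall _ _).union (isClopen_twoBall _ _)

theorem compSet_infinite (t n k : ℕ) : (compSet t n k).Infinite :=
  (twoBall_infinite _ _).mono Set.subset_union_left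

theorem isFiniteUnionOfBalls_compSet (t n k : ℕ) : IsFiniteUnionOfBalls (compSet t n k) := by
  refine ⟨{((1 + 4 * (k : ℤ_[2])) * 2 ^ n, (2 : ℝ) ^ (-(n + t + 3 : ℕ) : ℤ)),
    ((2 ^ (t + 2) - 1 - 4 * (k : ℤ_[2])) * 2 ^ n, (2 : ℝ) ^ (-(n + t + 3 : ℕ) : ℤ))},
    by simp, ?_, ?_⟩
  · rintro c (rfl | rfl) <;> positivity
  · rw [Set.biUnion_pair, compSet, twoBall_eq_closedBall, twoBall_eq_closedBall]

theorem mem_closure_of_two_pow_dvd {S : Set ℤ_[2]} {y : ℤ_[2]}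
    (h : ∀ l : ℕ, ∃ s ∈ S, (2 : ℤ_[2]) ^ l ∣ y - s) : y ∈ closure S := by
  rw [Metric.mem_closure_iff]
  intro ε hε
  obtain ⟨l, hl⟩ := exists_pow_lt_of_lt_one hε (by norm_num : (2⁻¹ : ℝ) < 1)
  obtain ⟨s, hs, hd⟩ := h l
  refine ⟨s, hs, ?_⟩
  rw [dist_eq_norm]
  refine (two_pow_dvd_iff_norm_le.mp hd).trans_lt ?_
  rwa [zpow_neg, zpow_natCast, ← inv_pow]

/-! ### The components -/

theorem mem_compSet_iff {t n k : ℕ} {x : ℤ_[2]} :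
    x ∈ compSet t n k ↔ ∃ u : ℤ_[2], Odd u ∧ x = 2 ^ n * u ∧
      ((2 : ℤ_[2]) ^ (t + 3) ∣ u - (1 + 4 * k) ∨
        (2 : ℤ_[2]) ^ (t + 3) ∣ u - (2 ^ (t + 2) - (1 + 4 * k))) := by
  constructor
  · rintro (⟨z, rfl⟩ | ⟨z, rfl⟩)
    · exact ⟨1 + 4 * k + 2 ^ (t + 3) * z, ⟨2 * k + 2 ^ (t + 2) * z, by ring⟩, by ring,
        .inl ⟨z, by ring⟩⟩
    · exact ⟨2 ^ (t + 2) - (1 + 4 * k) + 2 ^ (t + 3) * z,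
        ⟨2 ^ (t + 1) - 1 - 2 * k + 2 ^ (t + 2) * z, by ring⟩, by ring, .inr ⟨z, by ring⟩⟩
  · rintro ⟨u, -, rfl, ⟨z, hz⟩ | ⟨z, hz⟩⟩
    · exact .inl ⟨z, by rw [sub_eq_iff_eq_add.mp hz]; ring⟩
    · exact .inr ⟨z, by rw [sub_eq_iff_eq_add.mp hz]; ring⟩

theorem exists_lt_two_pow_dvd_sub (z : ℤ_[2]) (N : ℕ) :
    ∃ k < 2 ^ N, (2 : ℤ_[2]) ^ N ∣ z - (k : ℕ) := by
  refine ⟨PadicInt.appr z N, PadicInt.appr_lt z N, ?_⟩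
  have h := PadicInt.appr_spec N z
  rw [Ideal.mem_span_singleton] at h
  exact_mod_cast h

/-- The two balls of a component correspond to $u\equiv1$ and $u\equiv3$ mod 4, and within each
class $k$ is a residue mod $2^{t+1}$. -/
theorem exists_mem_compSet (t n : ℕ) {u : ℤ_[2]} (hu : Odd u) :
    ∃ k < 2 ^ (t + 1), 2 ^ n * u ∈ compSet t n k := by
  obtain ⟨v, hv⟩ := id hu
  rcases two_adic_even_or_odd v with ⟨w, hw⟩ | ⟨w, hw⟩
  · obtain ⟨k, hk, c, hc⟩ := exists_lt_two_pow_dvd_sub w (t + 1)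
    refine ⟨k, hk, mem_compSet_iff.mpr ⟨u, hu, rfl, .inl ⟨c, ?_⟩⟩⟩
    rw [hv, hw]
    linear_combination 4 * hc
  -- Here $u=3+4w$; solving $2^{t+2}-1-4k=3+4w$ gives $k=2^t-1-w$.
  · obtain ⟨k, hk, c, hc⟩ := exists_lt_two_pow_dvd_sub (2 ^ t - 1 - w) (t + 1)
    refine ⟨k, hk, mem_compSet_iff.mpr ⟨u, hu, rfl, .inr ⟨-c, ?_⟩⟩⟩
    rw [hv, hw]
    linear_combination -4 * hc

theorem compSet_index_unique {t n n' k k' : ℕ} (hk : k < 2 ^ (t + 1)) (hk' : k' < 2 ^ (t + 1))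
    {x : ℤ_[2]} (hx : x ∈ compSet t n k) (hx' : x ∈ compSet t n' k') : n = n' ∧ k = k' := by
  obtain ⟨u, hu, rfl, h⟩ := mem_compSet_iff.mp hx
  obtain ⟨u', hu', he, h'⟩ := mem_compSet_iff.mp hx'
  obtain ⟨rfl, rfl⟩ := two_pow_mul_odd_inj hu hu' he
  refine ⟨rfl, ?_⟩
  have four_ne : (4 : ℤ_[2]) ≠ 0 := by norm_num
  have cancel4 : ∀ {a c : ℤ_[2]}, 4 * a = 4 * c → a = c := fun h => mul_left_cancel₀ four_ne h
  have not_one : ∀ c : ℤ_[2], (1 : ℤ_[2]) ≠ 2 * c := fun c hc =>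
    two_adic_not_dvd_of_odd odd_one ⟨c, hc⟩
  have cancel2 : ∀ {a c : ℤ_[2]}, 2 * a = 2 * c → a = c :=
    fun h => mul_left_cancel₀ two_ne_zero h
  rcases h with ⟨z, hz⟩ | ⟨z, hz⟩ <;> rcases h' with ⟨z', hz'⟩ | ⟨z', hz'⟩
  · refine two_pow_dvd_natCast_sub hk hk' ⟨z' - z, cancel4 ?_⟩
    linear_combination hz' - hz
  -- In the mixed cases $u$ would be both 1 and 3 mod 4; dividing by 2 makes 1 even.
  · refine absurd (cancel2 ?_) (not_one (2 ^ t - k' - k + 2 ^ (t + 1) * (z' - z)))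
    linear_combination hz' - hz
  · refine absurd (cancel2 ?_) (not_one (2 ^ t - k' - k + 2 ^ (t + 1) * (z - z')))
    linear_combination hz - hz'
  · refine two_pow_dvd_natCast_sub hk hk' ⟨z - z', cancel4 ?_⟩
    linear_combination hz - hz'

/-! ### The arithmetic of `t(q)` -/

theorem mod_two_pow_succ_eq (x i : ℕ) :
    x % 2 ^ (i + 1) = x % 2 ^ i + 2 ^ i * (x.testBit i).toNat := by
  rw [Nat.mod_pow_succ, Nat.toNat_testBit]

/-- Up to index $t$ the digits alternate, starting from 0, so the truncations of $q$ approximate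
$-2/3$ in $\mathbb{Z}_2$. -/
theorem three_mul_mod_add_two {q : ℕ} (h0 : q.testBit 0 = false) (i : ℕ) (hi : i ≤ tInv q) :
    3 * (q % 2 ^ i) + 2 = 2 ^ i * (2 - (q.testBit i).toNat) := by
  induction i with
  | zero => simp [h0, Nat.mod_one]
  | succ i ih =>
    have hne : q.testBit i ≠ q.testBit (i + 1) := fun h =>
      absurd ((tInv_isLeast q).2 h) (by omega)
    have h1 := ih (by omega)
    rw [mod_two_pow_succ_eq, pow_succ]
    cases hb : q.testBit i <;> cases hc : q.testBit (i + 1) <;> (simp_all; try omega)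

/-- The first repeated digit breaks the approximation to $-2/3$: with $e=\lfloor q/2^{t+2}\rfloor$,
the odd factor is $1+6e$ if the repeated digit is 0 and $5+6e$ if it is 1. -/
theorem exists_three_mul_add_two_eq {q : ℕ} (h0 : q.testBit 0 = false) :
    ∃ o : ℕ, Odd o ∧ 3 * q + 2 = 2 ^ (tInv q + 1) * o := by
  have h1 := three_mul_mod_add_two h0 _ le_rfl
  have heq : q.testBit (tInv q) = q.testBit (tInv q + 1) := (tInv_isLeast q).1
  generalize tInv q = t at *
  have h2 := Nat.mod_add_div q (2 ^ (t + 2))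
  have h3 : q % 2 ^ (t + 2) = _ := mod_two_pow_succ_eq q (t + 1)
  rw [mod_two_pow_succ_eq q t, ← heq] at h3
  generalize q / 2 ^ (t + 2) = e at *
  cases hb : q.testBit t
  · refine ⟨1 + 2 * (3 * e), by simp, ?_⟩
    simp only [hb, Bool.toNat_false] at h1 h3
    rw [← h2, h3]
    linear_combination h1
  · refine ⟨1 + 2 * (2 + 3 * e), by simp, ?_⟩
    simp only [hb, Bool.toNat_true] at h1 h3
    rw [← h2, h3]
    linear_combination h1

/-! ### Fibonacci polynomials of even index -/

theorem fibMap_zero (x : ℤ_[2]) : fibMap 0 x = 0 := by simp [fibMap, fibPoly]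

theorem fibMap_one (x : ℤ_[2]) : fibMap 1 x = 1 := by simp [fibMap, fibPoly]

theorem fibMap_add_two (m : ℕ) (x : ℤ_[2]) :
    fibMap (m + 2) x = x * fibMap (m + 1) x + fibMap m x := by
  simp [fibMap, fibPoly]

/-- Even and odd indices are proved together by Pascal's rule. The common bound `N` keeps the
summation range fixed during the induction on `r`; the extra binomials vanish. -/
theorem fibMap_eq_sum_choose (r N : ℕ) (hN : r ≤ N) (x : ℤ_[2]) :
    fibMap (2 * r) x = ∑ i ∈ Finset.range (N + 1), ((r + i).choose (2 * i + 1) : ℤ_[2]) *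
        x ^ (2 * i + 1) ∧
      fibMap (2 * r + 1) x = ∑ i ∈ Finset.range (N + 1), ((r + i).choose (2 * i) : ℤ_[2]) *
        x ^ (2 * i) := by
  induction r with
  | zero =>
    constructor
    · rw [Finset.sum_eq_zero]
      · simp [fibMap_zero]
      · intro i _
        rw [Nat.choose_eq_zero_of_lt (by omega)]
        simp
    · rw [Finset.sum_eq_single 0]
      · simp [fibMap_one]
      · intro i _ hi
        rw [Nat.choose_eq_zero_of_lt (by omega)]
        simp
      · simp
  | succ r ih =>
    obtain ⟨h1, h2⟩ := ih (by omega)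
    have h3 : fibMap (2 * (r + 1)) x = ∑ i ∈ Finset.range (N + 1),
        ((r + 1 + i).choose (2 * i + 1) : ℤ_[2]) * x ^ (2 * i + 1) := by
      rw [show 2 * (r + 1) = 2 * r + 2 by ring, fibMap_add_two, h1, h2, Finset.mul_sum,
        ← Finset.sum_add_distrib]
      refine Finset.sum_congr rfl fun i _ => ?_
      rw [show r + 1 + i = (r + i) + 1 by ring, Nat.choose_succ_succ' (r + i) (2 * i)]
      push_cast
      ring
    refine ⟨h3, ?_⟩
    rw [show 2 * (r + 1) + 1 = (2 * r + 1) + 2 by ring, fibMap_add_two,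
      show 2 * r + 1 + 1 = 2 * (r + 1) by ring, h3, h2, Finset.mul_sum,
      Finset.sum_range_succ (fun i => x * _), Finset.sum_range_succ' (fun i => _ * x ^ (2 * i)),
      Finset.sum_range_succ' (fun i => _ * x ^ (2 * i)), Nat.choose_eq_zero_of_lt
        (show r + 1 + N < 2 * N + 1 by omega)]
    have key : ∀ i ∈ Finset.range N,
        ((r + 1 + (i + 1)).choose (2 * (i + 1)) : ℤ_[2]) * x ^ (2 * (i + 1)) =
          x * (((r + 1 + i).choose (2 * i + 1) : ℤ_[2]) * x ^ (2 * i + 1)) +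
            ((r + (i + 1)).choose (2 * (i + 1)) : ℤ_[2]) * x ^ (2 * (i + 1)) := by
      intro i _
      rw [show r + 1 + (i + 1) = (r + 1 + i) + 1 by ring, show 2 * (i + 1) = (2 * i + 1) + 1 by ring,
        Nat.choose_succ_succ' (r + 1 + i) (2 * i + 1), show r + (i + 1) = r + 1 + i by ring]
      push_cast
      ring
    rw [Finset.sum_congr rfl key, Finset.sum_add_distrib]
    simp
    ring

theorem fibMap_two_mul_eq_sum (r : ℕ) (x : ℤ_[2]) :
    fibMap (2 * r) x = r * x + ∑ i ∈ Finset.range r, ((r + (i + 1)).choose (2 * (i + 1) + 1) : ℤ_[2])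
      * x ^ (2 * (i + 1) + 1) := by
  rw [(fibMap_eq_sum_choose r r le_rfl x).1, Finset.sum_range_succ']
  simp
  ring

theorem choose_step (r i : ℕ) :
    ((r + (i + 1)).choose (2 * (i + 1) + 1) : ℤ) * ((2 * i + 3) * (2 * i + 2)) =
      ((r + i).choose (2 * i + 1) : ℤ) * ((r + i + 1) * (r - i - 1)) := by
  have h1 : ((r + i + 1 : ℕ) : ℤ) * ((r + i).choose (2 * i + 2) : ℤ) =
      ((r + i + 1).choose (2 * i + 3) : ℤ) * (2 * i + 3 : ℕ) := by
    exact_mod_cast Nat.add_one_mul_choose_eq (r + i) (2 * i + 2)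
  have h2 : ((r + i).choose (2 * i + 2) : ℤ) * (2 * i + 2 : ℕ) =
      ((r + i).choose (2 * i + 1) : ℤ) * (r - i - 1) := by
    rcases Nat.lt_or_ge r (i + 1) with h | h
    · rw [Nat.choose_eq_zero_of_lt (show r + i < 2 * i + 2 by omega),
        Nat.choose_eq_zero_of_lt (show r + i < 2 * i + 1 by omega)]
      simp
    · have := Nat.choose_succ_right_eq (r + i) (2 * i + 1)
      rw [show (r : ℤ) - i - 1 = ((r + i - (2 * i + 1) : ℕ) : ℤ) by omega]
      exact_mod_cast this
  push_cast at h1 h2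
  rw [show r + (i + 1) = r + i + 1 by ring, show 2 * (i + 1) + 1 = 2 * i + 3 by ring]
  linear_combination (-(2 * (i : ℤ) + 2)) * h1 + ((r : ℤ) + i + 1) * h2

/-- The right side is the product of the $2i+3$ consecutive integers from $r-i-1$ to $r+i+1$, which
include $r\pm1$. -/
theorem sq_sub_one_dvd_choose_mul_factorial (r i : ℕ) :
    ((r : ℤ) + 1) * (r - 1) ∣
      ((r + (i + 1)).choose (2 * (i + 1) + 1) : ℤ) * (2 * (i + 1) + 1).factorial := by
  have step : ∀ i : ℕ, ((r + (i + 1)).choose (2 * (i + 1) + 1) : ℤ) *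
      (2 * (i + 1) + 1).factorial =
      ((r + i).choose (2 * i + 1) : ℤ) * (2 * i + 1).factorial * ((r + i + 1) * (r - i - 1)) := by
    intro i
    have hf : ((2 * (i + 1) + 1).factorial : ℤ) =
        (2 * i + 3) * (2 * i + 2) * (2 * i + 1).factorial := by
      rw [show 2 * (i + 1) + 1 = 2 * i + 1 + 1 + 1 by ring, Nat.factorial_succ, Nat.factorial_succ]
      push_cast
      ring
    rw [hf]
    linear_combination ((2 * i + 1).factorial : ℤ) * choose_step r i
  induction i with
  | zero =>
    rw [step 0]
    exact ⟨r, by simp; ring⟩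
  | succ i ih =>
    rw [step (i + 1)]
    exact ih.mul_right _

theorem exists_two_mul_factorial (i : ℕ) :
    ∃ v o : ℕ, v ≤ 2 * i + 1 ∧ Odd o ∧ (2 * (i + 1) + 1).factorial = 2 ^ v * o := by
  obtain ⟨v, o, ho, h⟩ := Nat.exists_eq_two_pow_mul_odd (Nat.factorial_ne_zero (2 * (i + 1)))
  have hlt := Nat.emultiplicity_two_factorial_lt (n := 2 * (i + 1)) (by omega)
  have hv : (v : ℕ∞) ≤ emultiplicity 2 (2 * (i + 1)).factorial :=
    le_emultiplicity_of_pow_dvd ⟨o, h⟩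
  have hv2 : v < 2 * (i + 1) := by exact_mod_cast hv.trans_lt hlt
  refine ⟨v, (2 * (i + 1) + 1) * o, by omega, Odd.mul (odd_two_mul_add_one _) ho, ?_⟩
  rw [Nat.factorial_succ, h]
  ring

/-! ### The map on even points -/

/-- Up to an odd factor, the denominator $(2i+3)!$ is $2^v$ with $v\le 2i+1$, while $x^{2i+2}$
supplies $2^{2i+2}$: one factor 2 is left over. Another comes from $r-1$, and $2^s$ from $r+1$. -/
theorem two_pow_dvd_choose_mul_pow {r s : ℕ} (hr : (2 : ℤ_[2]) ^ s ∣ r + 1) (hr1 : Odd r)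
    (i : ℕ) (x : ℤ_[2]) (hx : Even x) :
    (2 : ℤ_[2]) ^ (s + 2) ∣
      ((r + (i + 1)).choose (2 * (i + 1) + 1) : ℤ_[2]) * x ^ (2 * (i + 1)) := by
  obtain ⟨v, o, hv, ho, hf⟩ := exists_two_mul_factorial i
  obtain ⟨e, he⟩ := Nat.exists_eq_add_of_le hv
  obtain ⟨K, hK⟩ := sq_sub_one_dvd_choose_mul_factorial r i
  rw [hf] at hK
  have hK2 := congrArg (Int.cast : ℤ → ℤ_[2]) hK
  push_cast at hK2
  obtain ⟨a, ha⟩ := hr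
  obtain ⟨b, hb⟩ : ∃ b : ℤ_[2], (r : ℤ_[2]) - 1 = 2 * b := by
    obtain ⟨b, rfl⟩ := hr1
    exact ⟨b, by push_cast; ring⟩
  obtain ⟨y, rfl⟩ := hx.two_dvd
  refine two_pow_dvd_of_dvd_odd_mul (u := (o : ℤ_[2])) ho.natCast ?_
  have h2 : (2 : ℤ_[2]) ^ (2 * (i + 1)) = 2 ^ v * 2 ^ e * 2 := by
    rw [show 2 * (i + 1) = v + e + 1 by omega]
    ring
  refine ⟨2 ^ e * a * b * K * y ^ (2 * (i + 1)), ?_⟩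
  rw [mul_pow, h2]
  rw [ha, hb] at hK2
  linear_combination (2 ^ e * 2 * y ^ (2 * (i + 1))) * hK2

theorem fibMap_even_eq_mul {r s : ℕ} (hr : (2 : ℤ_[2]) ^ s ∣ r + 1) (hr1 : Odd r)
    {x : ℤ_[2]} (hx : Even x) :
    ∃ e : ℤ_[2], fibMap (2 * r) x = x * (r + 2 ^ (s + 2) * e) := by
  have hd : (2 : ℤ_[2]) ^ (s + 2) ∣ ∑ i ∈ Finset.range r,
      ((r + (i + 1)).choose (2 * (i + 1) + 1) : ℤ_[2]) * x ^ (2 * (i + 1)) :=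
    Finset.dvd_sum fun i _ => two_pow_dvd_choose_mul_pow hr hr1 i x hx
  obtain ⟨e, he⟩ := hd
  refine ⟨e, ?_⟩
  rw [fibMap_two_mul_eq_sum, mul_add, ← he, Finset.mul_sum, mul_comm x]
  congr 1
  refine Finset.sum_congr rfl fun i _ => ?_
  ring

theorem four_mul_sub_dvd_pow_sub_pow {x y : ℤ_[2]} (hx : Even x) (hy : Even y) (i : ℕ) :
    4 * (x - y) ∣ x ^ (2 * (i + 1) + 1) - y ^ (2 * (i + 1) + 1) := by
  obtain ⟨a, rfl⟩ := hx.two_dvd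
  obtain ⟨b, rfl⟩ := hy.two_dvd
  obtain ⟨c, hc⟩ := sub_dvd_pow_sub_pow a b (2 * (i + 1) + 1)
  refine ⟨2 ^ (2 * i) * c, ?_⟩
  rw [mul_pow, mul_pow, ← mul_sub, hc]
  ring

theorem fibMap_sub_fibMap {r : ℕ} (hr : (4 : ℤ_[2]) ∣ r + 1) {x y : ℤ_[2]}
    (hx : Even x) (hy : Even y) :
    ∃ e : ℤ_[2], fibMap (2 * r) x - fibMap (2 * r) y = (x - y) * (-1 + 4 * e) := by
  have hd : 4 * (x - y) ∣ ∑ i ∈ Finset.range r,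
      ((r + (i + 1)).choose (2 * (i + 1) + 1) : ℤ_[2]) *
        (x ^ (2 * (i + 1) + 1) - y ^ (2 * (i + 1) + 1)) :=
    Finset.dvd_sum fun i _ => (four_mul_sub_dvd_pow_sub_pow hx hy i).mul_left _
  obtain ⟨e, he⟩ := hd
  obtain ⟨a, ha⟩ := hr
  refine ⟨a + e, ?_⟩
  simp only [mul_sub, Finset.sum_sub_distrib] at he
  rw [fibMap_two_mul_eq_sum, fibMap_two_mul_eq_sum]
  linear_combination he + (x - y) * ha

/-! ### Orbits of maps with derivative one modulo four -/

/-- If `F` has difference quotients `≡ 1 mod 4` on an invariant set `A` and moves each point of `A`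
by a distance exactly `2^{-b}`, then `F^{2^j}` has the same properties with `b + j`. -/
theorem iterate_two_pow_sub_eq {A : Set ℤ_[2]} {F : ℤ_[2] → ℤ_[2]} (hA : Set.MapsTo F A A)
    (hF : ∀ x ∈ A, ∀ y ∈ A, ∃ e : ℤ_[2], F x - F y = (x - y) * (1 + 4 * e)) {b : ℕ}
    (hb : ∀ x ∈ A, ∃ o : ℤ_[2], Odd o ∧ F x - x = 2 ^ b * o) (j : ℕ) :
    (∀ x ∈ A, ∀ y ∈ A, ∃ e : ℤ_[2],
        F^[2 ^ j] x - F^[2 ^ j] y = (x - y) * (1 + 4 * e)) ∧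
      ∀ x ∈ A, ∃ o : ℤ_[2], Odd o ∧ F^[2 ^ j] x - x = 2 ^ (b + j) * o := by
  induction j with
  | zero => simpa using ⟨hF, hb⟩
  | succ j ih =>
    obtain ⟨h1, h2⟩ := ih
    have hm : Set.MapsTo F^[2 ^ j] A A := hA.iterate _
    have hit : ∀ x, F^[2 ^ (j + 1)] x = F^[2 ^ j] (F^[2 ^ j] x) := fun x => by
      rw [pow_succ, mul_two, Function.iterate_add_apply]
    constructor
    · intro x hx y hy
      obtain ⟨e, he⟩ := h1 x hx y hy
      obtain ⟨e', he'⟩ := h1 _ (hm hx) _ (hm hy)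
      refine ⟨e + e' + 4 * e * e', ?_⟩
      rw [hit, hit, he', he]
      ring
    · intro x hx
      obtain ⟨o, ho, hxo⟩ := h2 x hx
      obtain ⟨e, he⟩ := h1 _ (hm hx) _ hx
      refine ⟨o * (1 + 2 * e), ho.mul ⟨e, by ring⟩, ?_⟩
      rw [hit]
      -- With $G=F^{2^j}$, $G^2x-x=(Gx-x)(2+4e)$: exactly one more factor 2.
      linear_combination he + (2 + 4 * e) * hxo

theorem exists_iterate_two_pow_dvd_sub {A : Set ℤ_[2]} {F : ℤ_[2] → ℤ_[2]}
    (hA : Set.MapsTo F A A)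
    (hF : ∀ x ∈ A, ∀ y ∈ A, ∃ e : ℤ_[2], F x - F y = (x - y) * (1 + 4 * e)) {b : ℕ}
    (hb : ∀ x ∈ A, ∃ o : ℤ_[2], Odd o ∧ F x - x = 2 ^ b * o) {x y : ℤ_[2]} (hx : x ∈ A)
    (hxy : (2 : ℤ_[2]) ^ b ∣ y - x) (j : ℕ) : ∃ i, (2 : ℤ_[2]) ^ (b + j) ∣ y - F^[i] x := by
  induction j with
  | zero => exact ⟨0, hxy⟩
  | succ j ih =>
    obtain ⟨i, c, hc⟩ := ih
    rcases two_adic_even_or_odd c with ⟨w, hw⟩ | hodd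
    · exact ⟨i, w, by rw [hc, hw]; ring⟩
    -- A wrong digit at position $b+j$ is corrected by $F^{2^j}$, which changes the point by an odd
    -- multiple of $2^{b+j}$.
    · obtain ⟨o, ho, hxo⟩ := (iterate_two_pow_sub_eq hA hF hb j).2 _ (hA.iterate i hx)
      obtain ⟨w, hw⟩ := hodd.sub_odd ho
      refine ⟨2 ^ j + i, w, ?_⟩
      rw [Function.iterate_add_apply]
      linear_combination hc - hxo + 2 ^ (b + j) * hw

/-! ### Dynamics on the components -/

theorem fibMap_even_eq_mul_neg_one_add {r s : ℕ} {o : ℤ_[2]} (hr1 : Odd r)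
    (hr : (r : ℤ_[2]) + 1 = 2 ^ s * o) {x : ℤ_[2]} (hx : Even x) :
    ∃ e : ℤ_[2], fibMap (2 * r) x = x * (-1 + 2 ^ s * (o + 4 * e)) := by
  obtain ⟨e, he⟩ := fibMap_even_eq_mul ⟨o, hr⟩ hr1 hx
  refine ⟨e, ?_⟩
  rw [he]
  linear_combination x * hr

theorem even_two_pow_mul {n : ℕ} (hn : 1 ≤ n) (u : ℤ_[2]) : Even ((2 : ℤ_[2]) ^ n * u) :=
  (even_iff_two_dvd.mpr (dvd_pow_self 2 (by omega))).mul_right u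

theorem fibMap_two_pow_mul_odd {r s : ℕ} {o : ℤ_[2]} (ho : Odd o) (hr1 : Odd r)
    (hr : (r : ℤ_[2]) + 1 = 2 ^ s * o) {n : ℕ} (hn : 1 ≤ n) {u : ℤ_[2]} (hu : Odd u) :
    ∃ w : ℤ_[2], Odd w ∧ fibMap (2 * r) (2 ^ n * u) = 2 ^ n * (-u + 2 ^ s * w) := by
  obtain ⟨e, he⟩ := fibMap_even_eq_mul_neg_one_add hr1 hr (even_two_pow_mul hn u)
  refine ⟨u * (o + 2 * (2 * e)), hu.mul (ho.add_even (even_two_mul _)), ?_⟩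
  rw [he]
  ring

/-- The multiplier is $(-1+2^{s+2}A)(-1+2^{s+2}B)$ with $A,B\equiv o$ mod 4. As $A+B\equiv2$ mod 4,
it differs from 1 by exactly $2^{s+3}$ times an odd number. -/
theorem fibMap_fibMap_two_pow_mul_odd_sub {r s : ℕ} {o : ℤ_[2]} (ho : Odd o) (hr1 : Odd r)
    (hr : (r : ℤ_[2]) + 1 = 2 ^ (s + 2) * o) {n : ℕ} (hn : 1 ≤ n) {u : ℤ_[2]} (hu : Odd u) :
    ∃ w : ℤ_[2], Odd w ∧ fibMap (2 * r) (fibMap (2 * r) (2 ^ n * u)) - 2 ^ n * u =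
      2 ^ (n + s + 3) * w := by
  have hx := even_two_pow_mul hn u
  obtain ⟨e, he⟩ := fibMap_even_eq_mul_neg_one_add hr1 hr hx
  have hx' : Even (fibMap (2 * r) (2 ^ n * u)) := by
    rw [he]
    exact hx.mul_right _
  obtain ⟨e', he'⟩ := fibMap_even_eq_mul_neg_one_add hr1 hr hx'
  refine ⟨u * (o + 2 * (-o - e - e' + 2 ^ s * ((o + 4 * e) * (o + 4 * e')))),
    hu.mul (ho.add_even (even_two_mul _)), ?_⟩
  rw [he', he]
  ring

theorem fibMap_mapsTo_compSet {r t : ℕ} {o : ℤ_[2]} (ho : Odd o) (hr1 : Odd r)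
    (hr : (r : ℤ_[2]) + 1 = 2 ^ (t + 2) * o) {n : ℕ} (hn : 1 ≤ n) (k : ℕ) :
    Set.MapsTo (fibMap (2 * r)) (compSet t n k) (compSet t n k) := by
  intro x hx
  obtain ⟨u, hu, rfl, h⟩ := mem_compSet_iff.mp hx
  obtain ⟨w, ⟨c, rfl⟩, he⟩ := fibMap_two_pow_mul_odd ho hr1 hr hn hu
  refine mem_compSet_iff.mpr ⟨_, ?_, he, ?_⟩
  · exact hu.neg.add_even ((even_two_pow_mul (by omega) _))
  · rcases h with ⟨z, hz⟩ | ⟨z, hz⟩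
    · exact .inr ⟨c - z, by linear_combination -hz⟩
    · exact .inl ⟨c - z, by linear_combination -hz⟩

theorem fibMap_fibMap_sub {r : ℕ} (hr1 : Odd r) (hr : (4 : ℤ_[2]) ∣ r + 1) {x y : ℤ_[2]}
    (hx : Even x) (hy : Even y) : ∃ e : ℤ_[2],
      (fibMap (2 * r))^[2] x - (fibMap (2 * r))^[2] y = (x - y) * (1 + 4 * e) := by
  obtain ⟨o, ho⟩ := hr
  have hev : ∀ {z : ℤ_[2]}, Even z → Even (fibMap (2 * r) z) := fun {z} hz => by
    obtain ⟨e, he⟩ := fibMap_even_eq_mul_neg_one_add (s := 2) (o := o) hr1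
      (by rw [ho]; ring) hz
    rw [he]
    exact hz.mul_right _
  obtain ⟨e, he⟩ := fibMap_sub_fibMap ⟨o, ho⟩ hx hy
  obtain ⟨e', he'⟩ := fibMap_sub_fibMap ⟨o, ho⟩ (hev hx) (hev hy)
  refine ⟨-e - e' + 4 * e * e', ?_⟩
  simp only [Function.iterate_succ, Function.iterate_zero, Function.comp_apply, id]
  rw [he', he]
  ring

theorem isMinimalSubsystem_compSet {r t : ℕ} {o : ℤ_[2]} (ho : Odd o) (hr1 : Odd r)
    (hr : (r : ℤ_[2]) + 1 = 2 ^ (t + 2) * o) {n : ℕ} (hn : 1 ≤ n) (k : ℕ) :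
    IsMinimalSubsystem (fibMap (2 * r)) (compSet t n k) := by
  have hmaps := fibMap_mapsTo_compSet ho hr1 hr hn k
  refine ⟨(compSet_infinite t n k).nonempty, hmaps, fun x hx y hy => ?_⟩
  have hev : ∀ z ∈ compSet t n k, Even z := fun z hz => by
    obtain ⟨u, -, rfl, -⟩ := mem_compSet_iff.mp hz
    exact even_two_pow_mul hn u
  have hr4 : (4 : ℤ_[2]) ∣ r + 1 := ⟨2 ^ t * o, by rw [hr]; ring⟩
  -- Within one ball, iterates of $F^2$ suffice; a target in the other ball is reached from $F(x)$.
  have near : ∀ z ∈ compSet t n k, (2 : ℤ_[2]) ^ (n + t + 3) ∣ y - z →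
      ∀ l : ℕ, ∃ i, (2 : ℤ_[2]) ^ l ∣ y - (fibMap (2 * r))^[i] z := by
    intro z hz hyz l
    obtain ⟨i, hi⟩ := exists_iterate_two_pow_dvd_sub (F := (fibMap (2 * r))^[2])
      (hmaps.iterate 2)
      (fun a ha b hb => fibMap_fibMap_sub hr1 hr4 (hev a ha) (hev b hb)) (b := n + t + 3)
      (fun a ha => by
        obtain ⟨u, hu, rfl, -⟩ := mem_compSet_iff.mp ha
        exact fibMap_fibMap_two_pow_mul_odd_sub ho hr1 hr hn hu) hz hyz l
    refine ⟨2 * i, ?_⟩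
    rw [Function.iterate_mul]
    exact (pow_dvd_pow 2 (Nat.le_add_left l _)).trans hi
  refine mem_closure_of_two_pow_dvd fun l => ?_
  obtain ⟨u, hu, hxu, h⟩ := mem_compSet_iff.mp hx
  obtain ⟨v, -, hyv, h'⟩ := mem_compSet_iff.mp hy
  obtain ⟨w, ⟨c, rfl⟩, he⟩ := fibMap_two_pow_mul_odd ho hr1 hr hn hu
  have same : (2 : ℤ_[2]) ^ (t + 3) ∣ v - u →
      ∃ s ∈ fwdOrbit (fibMap (2 * r)) x, (2 : ℤ_[2]) ^ l ∣ y - s := by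
    rintro ⟨z, hz⟩
    obtain ⟨i, hi⟩ := near x hx ⟨z, by rw [hxu, hyv]; linear_combination 2 ^ n * hz⟩ l
    exact ⟨_, ⟨i, rfl⟩, hi⟩
  have swap : (2 : ℤ_[2]) ^ (t + 3) ∣ v - (2 ^ (t + 2) - u) →
      ∃ s ∈ fwdOrbit (fibMap (2 * r)) x, (2 : ℤ_[2]) ^ l ∣ y - s := by
    rintro ⟨z, hz⟩
    obtain ⟨i, hi⟩ := near _ (hmaps hx)
      ⟨z - c, by rw [hxu, hyv, he]; linear_combination 2 ^ n * hz⟩ l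
    exact ⟨_, ⟨i + 1, rfl⟩, hi⟩
  rcases h with ⟨a, ha⟩ | ⟨a, ha⟩ <;> rcases h' with ⟨b, hb⟩ | ⟨b, hb⟩
  · exact same ⟨b - a, by linear_combination hb - ha⟩
  · exact swap ⟨b + a, by linear_combination hb + ha⟩
  · exact swap ⟨b + a, by linear_combination hb + ha⟩
  · exact same ⟨b - a, by linear_combination hb - ha⟩

/-- A periodic orbit is finite, hence closed, so it cannot be dense in an infinite set. -/
theorem IsMinimalSubsystem.not_mem_periodicPts {X : Type*} [TopologicalSpace X] [T1Space X]
    {f : X → X} {A : Set X} (h : IsMinimalSubsystem f A) (hA : A.Infinite) {x : X} (hx : x ∈ A) :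
    x ∉ Function.periodicPts f := by
  rintro ⟨p, hp, hper⟩
  have hfin : (fwdOrbit f x).Finite := by
    refine ((Set.finite_lt_nat p).image fun j => f^[j] x).subset ?_
    rintro _ ⟨j, rfl⟩
    exact ⟨j % p, Nat.mod_lt j hp, hper.iterate_mod_apply j⟩
  have hsub := h.dense x hx
  rw [hfin.isClosed.closure_eq] at hsub
  exact hA (hfin.subset hsub)

/-! ### Odd points -/

/-- At odd $x$ the recurrence mod 2 is the Fibonacci recurrence, of period 3: 0, 1, 1. -/
theorem fibMap_odd_parity {x : ℤ_[2]} (hx : Odd x) (j : ℕ) :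
    Even (fibMap (3 * j) x) ∧ Odd (fibMap (3 * j + 1) x) := by
  induction j with
  | zero => simp [fibMap_zero, fibMap_one]
  | succ j ih =>
    obtain ⟨h0, h1⟩ := ih
    have h2 : Odd (fibMap (3 * j + 2) x) := by
      rw [fibMap_add_two]
      exact (hx.mul h1).add_even h0
    have h3 : Even (fibMap (3 * j + 3) x) := by
      rw [fibMap_add_two]
      exact (hx.mul h2).add_odd h1
    refine ⟨h3, ?_⟩
    rw [show 3 * (j + 1) + 1 = 3 * j + 2 + 2 by ring, fibMap_add_two]
    exact (h3.mul_left x).add_odd h2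

theorem mem_twoBall_one_one_iff {x : ℤ_[2]} : x ∈ twoBall 1 1 ↔ Odd x := by
  constructor
  · rintro ⟨z, rfl⟩
    exact ⟨z, by ring⟩
  · rintro ⟨z, rfl⟩
    exact ⟨z, by ring⟩

theorem mem_attractingBasin_of_apply_mem {X : Type*} [PseudoEMetricSpace X] {f : X → X} {A : Set X}
    (hA : Set.MapsTo f A A) {x : X} (hx : f x ∈ A) : x ∈ attractingBasin f A := by
  refine tendsto_const_nhds.congr' ?_
  filter_upwards [eventually_ge_atTop 1] with j hj
  obtain ⟨i, rfl⟩ := Nat.exists_eq_add_of_le' hj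
  exact (Metric.infEDist_zero_of_mem (hA.iterate i hx)).symm

theorem eq_zero_or_mem_compSet_of_even (t : ℕ) {x : ℤ_[2]} (hx : Even x) :
    x = 0 ∨ ∃ i : ℕ+ × Fin (2 ^ (t + 1)), x ∈ compSet t (i.1 : ℕ) (i.2 : ℕ) := by
  refine or_iff_not_imp_left.mpr fun h0 => ?_
  obtain ⟨n, u, hu, rfl⟩ := exists_two_pow_mul_odd h0
  have hn : 0 < n := by
    rcases Nat.eq_zero_or_pos n with rfl | h
    · exact absurd hx (two_adic_not_even_of_odd (by simpa using hu))
    · exact h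
  obtain ⟨k, hk, h⟩ := exists_mem_compSet t n hu
  exact ⟨(⟨n, hn⟩, ⟨k, hk⟩), h⟩

theorem fibMap_fixes_zero (r : ℕ) : fibMap (2 * r) 0 = 0 := by
  rw [fibMap_two_mul_eq_sum]
  simp

theorem mainTheorem8 (m q d t : ℕ) (hm : m = 6 + 12 * q) (hq : q = 2 + 4 * d)
    (ht : t = tInv q) :
    -- the minimal decomposition `{0} ⊔ (⋃ M_{n,k}) ⊔ (1 + 2ℤ₂)`, `n ≥ 1`, `0 ≤ k < 2^{t+1}`
    IsMinimalDecomposition (fibMap m) {0}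
      (fun i : ℕ+ × Fin (2 ^ (t + 1)) => compSet t (i.1 : ℕ) (i.2 : ℕ)) (twoBall 1 1) ∧
    -- `0` is a fixed point
    fibMap m 0 = 0 ∧
    -- the clopen set `1 + 2ℤ₂` is the attracting basin of `{0}` and the `M_{n,k}`: the set of
    -- points outside these sets that are attracted by one of them
    IsClopen (twoBall 1 1) ∧
    twoBall 1 1 =
      (attractingBasin (fibMap m) {0} ∪
          ⋃ i : ℕ+ × Fin (2 ^ (t + 1)), attractingBasin (fibMap m) (compSet t (i.1 : ℕ) (i.2 : ℕ))) \
        ({0} ∪ ⋃ i : ℕ+ × Fin (2 ^ (t + 1)), compSet t (i.1 : ℕ) (i.2 : ℕ)) := by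
  obtain ⟨o', ho', hqo⟩ := exists_three_mul_add_two_eq (q := q) (by
    rw [Nat.testBit_zero, hq]
    simp
    omega)
  rw [← ht] at hqo
  set r := 3 + 6 * q with hrdef
  have hm2 : m = 2 * r := by omega
  have hm3 : m = 3 * (2 * (1 + 2 * q)) := by omega
  set o : ℤ_[2] := (o' : ℤ_[2]) with hodef
  have ho : Odd o := ho'.natCast
  have hr1 : Odd r := ⟨1 + 3 * q, by omega⟩
  have hr : (r : ℤ_[2]) + 1 = 2 ^ (t + 2) * o := by
    have h : ((3 * q + 2 : ℕ) : ℤ_[2]) = ((2 ^ (t + 1) * o' : ℕ) : ℤ_[2]) := congrArg _ hqo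
    push_cast at h
    rw [hrdef]
    push_cast
    linear_combination 2 * h
  clear_value r
  have hmin : ∀ i : ℕ+ × Fin (2 ^ (t + 1)),
      IsMinimalSubsystem (fibMap m) (compSet t (i.1 : ℕ) (i.2 : ℕ)) := fun i => by
    rw [hm2]
    exact isMinimalSubsystem_compSet ho hr1 hr i.1.pos _
  have hzero : fibMap m 0 = 0 := by rw [hm2, fibMap_fixes_zero]
  have hodd_even : ∀ {x : ℤ_[2]}, Odd x → Even (fibMap m x) := fun {x} hx => by
    rw [hm3]
    exact (fibMap_odd_parity hx _).1
  have hcomp_even : ∀ {x : ℤ_[2]} (i : ℕ+ × Fin (2 ^ (t + 1))),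
      x ∈ compSet t (i.1 : ℕ) (i.2 : ℕ) → Even x := fun {x} i hx => by
    obtain ⟨u, -, rfl, -⟩ := mem_compSet_iff.mp hx
    exact even_two_pow_mul i.1.pos u
  have hcomp_ne : ∀ {x : ℤ_[2]} (i : ℕ+ × Fin (2 ^ (t + 1))),
      x ∈ compSet t (i.1 : ℕ) (i.2 : ℕ) → x ≠ 0 := fun {x} i hx h0 => by
    obtain ⟨u, hu, rfl, -⟩ := mem_compSet_iff.mp hx
    have hu0 := (mul_eq_zero.mp h0).resolve_left (pow_ne_zero _ two_ne_zero)
    exact two_adic_not_even_of_odd hu (by simp [hu0])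
  have hiter_even : ∀ {x : ℤ_[2]}, Even x → Even (fibMap m x) := fun {x} hx => by
    obtain ⟨e, he⟩ := fibMap_even_eq_mul_neg_one_add hr1 hr hx
    rw [hm2, he]
    exact hx.mul_right _
  have hzper : (0 : ℤ_[2]) ∈ Function.periodicPts (fibMap m) :=
    Function.mk_mem_periodicPts one_pos hzero
  have hzmaps : Set.MapsTo (fibMap m) {0} {0} := by
    rintro _ rfl
    exact hzero
  have hzorbit : fwdOrbit (fibMap m) 0 = {0} := by
    ext y
    simp [fwdOrbit, Function.iterate_fixed hzero]
  have hattr : ∀ {x : ℤ_[2]}, Odd x → x ∈ attractingBasin (fibMap m) {0} ∨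
      ∃ i : ℕ+ × Fin (2 ^ (t + 1)),
        x ∈ attractingBasin (fibMap m) (compSet t (i.1 : ℕ) (i.2 : ℕ)) := fun {x} hx => by
    rcases eq_zero_or_mem_compSet_of_even t (hodd_even hx) with h | ⟨i, hi⟩
    · exact .inl (mem_attractingBasin_of_apply_mem hzmaps h)
    · exact .inr ⟨i, mem_attractingBasin_of_apply_mem (hmin i).mapsTo hi⟩
  have hodd_iff : ∀ {x : ℤ_[2]}, Odd x ↔
      ¬ (x = 0 ∨ ∃ i : ℕ+ × Fin (2 ^ (t + 1)), x ∈ compSet t (i.1 : ℕ) (i.2 : ℕ)) :=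
    fun {x} => by
      constructor
      · rintro hx (rfl | ⟨i, hi⟩)
        · exact two_adic_not_even_of_odd hx (by simp)
        · exact two_adic_not_even_of_odd hx (hcomp_even i hi)
      · intro h
        exact (two_adic_even_or_odd x).resolve_left fun he =>
          h (eq_zero_or_mem_compSet_of_even t he)
  refine ⟨{
    cover := ?_
    disjoint_P_M := ?_
    disjoint_P_B := ?_
    disjoint_M_B := ?_
    P_eq := ?_
    P_finite := Set.finite_singleton 0
    countable := inferInstance
    pairwise_disjoint := ?_
    isClopen := fun i => isClopen_compSet _ _ _
    balls := fun i => isFiniteUnionOfBalls_compSet _ _ _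
    minimal := hmin
    attracted := ?_ }, hzero, isClopen_twoBall 1 1, ?_⟩
  · ext x
    simp only [Set.mem_union, Set.mem_singleton_iff, Set.mem_iUnion, Set.mem_univ, iff_true,
      mem_twoBall_one_one_iff, hodd_iff]
    exact em _
  · rw [Set.disjoint_singleton_left, Set.mem_iUnion]
    rintro ⟨i, hi⟩
    exact hcomp_ne i hi rfl
  · rw [Set.disjoint_singleton_left, mem_twoBall_one_one_iff, hodd_iff]
    simp
  · refine Set.disjoint_left.mpr fun x hx hB => ?_
    rw [mem_twoBall_one_one_iff, hodd_iff] at hB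
    exact hB (.inr (Set.mem_iUnion.mp hx))
  · ext x
    rw [Set.mem_singleton_iff]
    constructor
    · rintro rfl
      exact hzper
    · intro hx
      rcases two_adic_even_or_odd x with he | hodd
      · refine (eq_zero_or_mem_compSet_of_even t he).resolve_right ?_
        rintro ⟨i, hi⟩
        exact (hmin i).not_mem_periodicPts (compSet_infinite _ _ _) hi hx
      -- After one step an odd point's orbit is even forever, so it never returns.
      · obtain ⟨p, hp, hper⟩ := hx
        obtain ⟨j, rfl⟩ := Nat.exists_eq_add_of_le' hp
        have hev : Even ((fibMap m)^[j] (fibMap m x)) :=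
          Set.MapsTo.iterate (s := {z : ℤ_[2] | Even z}) (fun _ hz => hiter_even hz) j
            (hodd_even hodd)
        have hx2 : (fibMap m)^[j] (fibMap m x) = x := hper
        rw [hx2] at hev
        exact absurd hev (two_adic_not_even_of_odd hodd)
  · rintro ⟨n, k⟩ ⟨n', k'⟩ hne
    refine Set.disjoint_left.mpr fun x hx hx' => hne ?_
    obtain ⟨h1, h2⟩ := compSet_index_unique k.2 k'.2 hx hx'
    exact Prod.ext (PNat.coe_injective h1) (Fin.ext h2)
  · intro x hx
    rcases hattr (mem_twoBall_one_one_iff.mp hx) with h | h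
    · exact .inl ⟨0, hzper, by rwa [hzorbit]⟩
    · exact .inr h
  · ext x
    simp only [Set.mem_sdiff, Set.mem_union, Set.mem_singleton_iff, Set.mem_iUnion,
      mem_twoBall_one_one_iff]
    exact ⟨fun hx => ⟨hattr hx, hodd_iff.mp hx⟩, fun h => hodd_iff.mpr h.2⟩
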